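/- Let $r\in\mathbb N$, $k\in\mathbb Z$ with $r\ge 1$ and $0\le k\le r-1$, let $\mathbb I=[-1,1]$ and let $\|\cdot\|_2$ be the norm of real $L_2(\mathbb I)$. For an integer $m\ge 1$ let $L_2^m$ be the space of functions $f:\mathbb I\to\mathbb R$ whose derivative $f^{(m-1)}$ exists and is absolutely continuous on $\mathbb I$ and for which $f^{(m)}\in L_2(\mathbb I)$, and let $W_2^r=\{f\in L_2^r:\ \|f^{(r)}\|_2\le 1\}$. Let $\Gamma_{-1}$ be the set of pairs $(A,B)$ of non-negative numbers such that $$|f^{(k)}(-1)|\le A\|f\|_2+B\|f^{(r)}\|_2\qquad\text{for all } f\in L_2^r,$$ with the sharp constant $B=\sup_{f\in W_2^r}\bigl(|f^{(k)}(-1)|-A\|f\|_2\bigr)$ (this supremum being finite). **Theorem.** For every $\lambda\ge 0$ the boundary value problem $$(-1)^r u^{(2r)}(x)+\lambda u(x)=0,\quad x\in(-1,1),$$ $$u^{(s)}(-1)=(-1)^{k-1}\delta_{r-k-1,s},\qquad u^{(s)}(1)=0,\qquad s=0,1,\dots,r-1,$$ has a unique solution $u=u_\lambda\in L_2^{2r}$,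 and $$\Gamma_{-1}=\left\{\left(\|u_\lambda^{(r)}\|_2,\ \|u_\lambda\|_2\right):\ \lambda\ge 0\right\}.$$ Moreover, if $M_{-1}$ denotes the sharp (least) constant in the Markov–Nikolskii inequality $|Q^{(k)}(-1)|\le M_{-1}\|Q\|_2$ for all real polynomials $Q$ of degree at most $r-1$, then $\|u_0^{(r)}\|_2=M_{-1}$ and $$\left\{\|u_\lambda^{(r)}\|_2:\ \lambda\ge 0\right\}=[M_{-1},+\infty).$$ -/

import Mathlib

noncomputable section

namespace LandauKolmogorov

/-- The interval `[-1, 1]`. -/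
def I : Set ℝ := Set.Icc (-1) 1

/-- The derivative of order `n` of a function on `[-1, 1]` (one-sided at the endpoints). -/
def D (n : ℕ) (f : ℝ → ℝ) : ℝ → ℝ := iteratedDerivWithin n f I

/-- The norm of `L_2(-1, 1)`. It is only used for square-integrable functions. -/
def norm2 (f : ℝ → ℝ) : ℝ := √(∫ x in (-1 : ℝ)..1, |f x| ^ 2)

/-- For `r ≥ 1`, the space `L_2^r`: the derivative of order `r - 1` exists on `[-1, 1]` and is
absolutely continuous there, and the derivative of order `r` (which then exists almost everywhere)
is square-integrable. Functions are defined on `ℝ`, but only their restriction to `[-1, 1]`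
matters. -/
structure MemL2 (r : ℕ) (f : ℝ → ℝ) : Prop where
  contDiffOn : ContDiffOn ℝ ((r - 1 : ℕ) : WithTop ℕ∞) f I
  absCont : AbsolutelyContinuousOnInterval (D (r - 1) f) (-1) 1
  memLp : MeasureTheory.MemLp (D r f) 2 (MeasureTheory.volume.restrict I)

/-- The class `W_2^r` of functions in `L_2^r` with `‖f^{(r)}‖₂ ≤ 1`. -/
def W (r : ℕ) : Set (ℝ → ℝ) := {f | MemL2 r f ∧ norm2 (D r f) ≤ 1}

/-- The set `Γ_t` of pairs `(A, B)` of non-negative numbers such that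
`|f^{(k)}(t)| ≤ A ‖f‖₂ + B ‖f^{(r)}‖₂` for all `f ∈ L_2^r`, where `B` is the (finite) supremum of
`|f^{(k)}(t)| - A ‖f‖₂` over `f ∈ W_2^r`. -/
def Gam (r k : ℕ) (t : ℝ) : Set (ℝ × ℝ) :=
  {p | 0 ≤ p.1 ∧ 0 ≤ p.2 ∧
    (∀ f, MemL2 r f → |D k f t| ≤ p.1 * norm2 f + p.2 * norm2 (D r f)) ∧
    IsLUB ((fun f => |D k f t| - p.1 * norm2 f) '' W r) p.2}

/-- `M` is the sharp (least) constant in the pointwise Markov–Nikolskii inequality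
`|Q^{(k)}(t)| ≤ M ‖Q‖₂` for real polynomials `Q` of degree at most `r - 1`. -/
def IsMarkovNikolskii (r k : ℕ) (t M : ℝ) : Prop :=
  IsLeast {M : ℝ | ∀ Q : Polynomial ℝ, Q.degree < (r : WithBot ℕ) →
    |(Polynomial.derivative^[k] Q).eval t| ≤ M * norm2 (fun x => Q.eval x)} M

/-- `u ∈ L_2^{2r}` solves the boundary value problem `(-1)^r u^{(2r)} + λ u = 0` on `(-1, 1)`,
`u^{(s)}(-1) = (-1)^{k-1} δ_{r-k-1,s}` and `u^{(s)}(1) = 0` for `s = 0, …, r - 1`.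
(The sign is written as `(-1)^(k+1)`, so that no truncated subtraction occurs.) -/
structure IsSol (r k : ℕ) (lam : ℝ) (u : ℝ → ℝ) : Prop where
  mem : MemL2 (2 * r) u
  eqn : ∀ x ∈ Set.Ioo (-1 : ℝ) 1, (-1) ^ r * D (2 * r) u x + lam * u x = 0
  left : ∀ s < r, D s u (-1) = if s + k + 1 = r then (-1) ^ (k + 1) else 0
  right : ∀ s < r, D s u 1 = 0

end LandauKolmogorov

end

open MeasureTheory Set Filter Topology
open scoped ContDiff

namespace LandauKolmogorov

/-! Integrating `f^{(r)} u` by parts `r` times leaves a single boundary term, because of the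
boundary data of `u`: `f^{(k)}(-1) = ∫ f u^{(r)} - (-1)^r ∫ f^{(r)} u` (`IsSol.representation`).
Cauchy–Schwarz then gives the inequality with `A = ‖u^{(r)}‖` and `B = ‖u‖`. For `λ > 0` the choice
`f = u^{(r)}` makes both estimates equalities, since the equation turns `f^{(r)}` into a multiple of
`u`; after scaling this proves sharpness (`IsSol.le_of_mem_upperBounds`), and `λ = 0` follows by a
limit.

At `λ = 0` the function `u^{(r)}` is a polynomial of degree less than `r`, extremal for the
Markov–Nikolskii inequality. Testing on polynomials therefore forces `A ≥ ‖u_0^{(r)}‖` for every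
admissible pair. As `A` determines `B`, it remains to see that `‖u_λ^{(r)}‖` attains every value
from `‖u_0^{(r)}‖` on: it is continuous in `λ` (`IsSol.sub_estimate`) and unbounded
(`exists_norm2_D_ge`). One energy estimate, `IsDerivChain.energy_estimate`, supplies existence,
uniqueness and continuity. -/

/-! ### The `L_2` norm on `[-1, 1]` -/

lemma uIcc_eq_I : uIcc (-1 : ℝ) 1 = I := uIcc_of_le (by norm_num)

lemma uniqueDiffOn_I : UniqueDiffOn ℝ I := uniqueDiffOn_Icc (by norm_num)

lemma neg_one_mem_I : (-1 : ℝ) ∈ I := ⟨le_rfl, by norm_num⟩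

lemma one_mem_I : (1 : ℝ) ∈ I := ⟨by norm_num, le_rfl⟩

lemma intervalIntegral_eq_setIntegral_I (f : ℝ → ℝ) :
    ∫ x in (-1 : ℝ)..1, f x = ∫ x in I, f x := by
  rw [intervalIntegral.integral_of_le (by norm_num), I, integral_Icc_eq_integral_Ioc]

lemma norm2_nonneg (f : ℝ → ℝ) : 0 ≤ norm2 f := Real.sqrt_nonneg _

lemma norm2_sq (f : ℝ → ℝ) : norm2 f ^ 2 = ∫ x in (-1 : ℝ)..1, f x * f x := by
  rw [norm2, Real.sq_sqrt]
  · simp only [sq_abs]; simp only [sq]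
  · exact intervalIntegral.integral_nonneg (by norm_num) fun _ _ => by positivity

lemma integral_congr_I {f g : ℝ → ℝ} (h : EqOn f g I) :
    ∫ x in (-1 : ℝ)..1, f x = ∫ x in (-1 : ℝ)..1, g x :=
  intervalIntegral.integral_congr fun _ hx => h (uIcc_eq_I ▸ hx)

/-- The differential equation is available on the open interval only; the endpoints are null. -/
lemma integral_congr_Ioo {f g : ℝ → ℝ} (h : EqOn f g (Ioo (-1) 1)) :
    ∫ x in (-1 : ℝ)..1, f x = ∫ x in (-1 : ℝ)..1, g x := by
  rw [intervalIntegral.integral_of_le (by norm_num), intervalIntegral.integral_of_le (by norm_num),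
    integral_Ioc_eq_integral_Ioo, integral_Ioc_eq_integral_Ioo]
  exact setIntegral_congr_fun measurableSet_Ioo h

lemma norm2_congr {f g : ℝ → ℝ} (h : EqOn f g I) : norm2 f = norm2 g := by
  rw [norm2, norm2, integral_congr_I (g := fun x => |g x| ^ 2) fun x hx => by simp only [h hx]]

lemma norm2_const_mul (c : ℝ) (f : ℝ → ℝ) : norm2 (fun x => c * f x) = |c| * norm2 f := by
  simp only [norm2, abs_mul, mul_pow, intervalIntegral.integral_const_mul]
  rw [Real.sqrt_mul (by positivity), Real.sqrt_sq (abs_nonneg c)]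

/-- Square-integrability on `[-1, 1]`. -/
abbrev SqIntegrable (f : ℝ → ℝ) : Prop := MemLp f 2 (volume.restrict I)

lemma sqIntegrable_of_continuousOn {f : ℝ → ℝ} (hf : ContinuousOn f I) : SqIntegrable f := by
  have hm : AEStronglyMeasurable f (volume.restrict I) :=
    hf.aestronglyMeasurable measurableSet_Icc
  rw [SqIntegrable, memLp_two_iff_integrable_sq hm]
  exact (hf.pow 2).integrableOn_compact isCompact_Icc

lemma SqIntegrable.intervalIntegrable_mul {f g : ℝ → ℝ} (hf : SqIntegrable f)
    (hg : SqIntegrable g) : IntervalIntegrable (fun x => f x * g x) volume (-1) 1 := by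
  have h := MemLp.integrable_mul hf hg
  rw [intervalIntegrable_iff_integrableOn_Icc_of_le (by norm_num)]
  exact h

lemma abs_integral_mul_le {f g : ℝ → ℝ} (hf : SqIntegrable f) (hg : SqIntegrable g) :
    |∫ x in (-1 : ℝ)..1, f x * g x| ≤ norm2 f * norm2 g := by
  have hpq : Real.HolderConjugate 2 2 := Real.HolderConjugate.two_two
  have h := integral_mul_norm_le_Lp_mul_Lq (μ := volume.restrict I) (f := f) (g := g) hpq
    (by simpa using hf) (by simpa using hg)
  simp only [norm2, intervalIntegral_eq_setIntegral_I]
  refine (abs_integral_le_integral_abs).trans ?_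
  simp only [abs_mul]
  simpa [Real.sqrt_eq_rpow] using h

/-! ### Integration by parts, Poincaré inequality and energy estimate -/

/-- A sequence of functions on `[-1, 1]` whose first `n` members are absolutely continuous, each
member being almost everywhere the derivative of the preceding one. -/
structure IsDerivChain (n : ℕ) (F : ℕ → ℝ → ℝ) : Prop where
  absCont : ∀ i < n, AbsolutelyContinuousOnInterval (F i) (-1) 1
  hasDerivAt : ∀ i < n, ∀ᵐ x : ℝ, x ∈ Ioo (-1 : ℝ) 1 → HasDerivAt (F i) (F (i + 1) x) x

lemma IsDerivChain.continuousOn {n : ℕ} {F : ℕ → ℝ → ℝ} (hF : IsDerivChain n F) {i : ℕ}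
    (hi : i < n) : ContinuousOn (F i) I := uIcc_eq_I ▸ (hF.absCont i hi).continuousOn

lemma IsDerivChain.shift {m n : ℕ} {F : ℕ → ℝ → ℝ} (hF : IsDerivChain (m + n) F) :
    IsDerivChain n fun i => F (m + i) :=
  ⟨fun i hi => hF.absCont (m + i) (by omega), fun i hi => hF.hasDerivAt (m + i) (by omega)⟩

lemma IsDerivChain.mono {m n : ℕ} {F : ℕ → ℝ → ℝ} (hF : IsDerivChain n F) (h : m ≤ n) :
    IsDerivChain m F :=
  ⟨fun i hi => hF.absCont i (by omega), fun i hi => hF.hasDerivAt i (by omega)⟩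

lemma IsDerivChain.sub {n : ℕ} {F G : ℕ → ℝ → ℝ} (hF : IsDerivChain n F)
    (hG : IsDerivChain n G) : IsDerivChain n fun i x => F i x - G i x := by
  refine ⟨fun i hi => (hF.absCont i hi).fun_sub (hG.absCont i hi), fun i hi => ?_⟩
  filter_upwards [hF.hasDerivAt i hi, hG.hasDerivAt i hi] with x h₁ h₂ hx
  exact (h₁ hx).sub (h₂ hx)

lemma ae_mem_Ioo_of_Ioc {a : ℝ} {p : ℝ → Prop}
    (h : ∀ᵐ x : ℝ, x ∈ Ioo (-1 : ℝ) 1 → p x) (ha : a ≤ 1) :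
    ∀ᵐ x : ℝ, x ∈ Ioc (-1 : ℝ) a → p x := by
  have h1 : ∀ᵐ x : ℝ, x ≠ 1 := by simp [ae_iff]
  filter_upwards [h, h1] with x h₁ h₂ hx
  exact h₁ ⟨hx.1, lt_of_le_of_ne (hx.2.trans ha) h₂⟩

lemma integral_deriv_congr {f f' g : ℝ → ℝ}
    (h : ∀ᵐ x : ℝ, x ∈ Ioo (-1 : ℝ) 1 → HasDerivAt f (f' x) x) {a : ℝ} (ha : -1 ≤ a)
    (ha' : a ≤ 1) : ∫ x in (-1 : ℝ)..a, g x * f' x = ∫ x in (-1 : ℝ)..a, g x * deriv f x := by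
  refine intervalIntegral.integral_congr_ae ?_
  rw [uIoc_of_le ha]
  filter_upwards [ae_mem_Ioo_of_Ioc h ha'] with x h₁ hx
  rw [(h₁ hx).deriv]

/-- Repeated integration by parts. -/
lemma IsDerivChain.integral_mul_sub {n : ℕ} {F G : ℕ → ℝ → ℝ} (hF : IsDerivChain n F)
    (hG : IsDerivChain n G) :
    (∫ x in (-1 : ℝ)..1, F n x * G 0 x) - (-1) ^ n * ∫ x in (-1 : ℝ)..1, F 0 x * G n x =
      ∑ s ∈ Finset.range n, (-1) ^ s *
        (F (n - 1 - s) 1 * G s 1 - F (n - 1 - s) (-1) * G s (-1)) := by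
  -- One integration by parts writes each boundary term as a difference of consecutive integrals, so
  -- the sum telescopes.
  have key : ∀ s < n, (-1 : ℝ) ^ s * (F (n - 1 - s) 1 * G s 1 - F (n - 1 - s) (-1) * G s (-1)) =
      (-1) ^ s * (∫ x in (-1 : ℝ)..1, F (n - s) x * G s x) -
      (-1) ^ (s + 1) * ∫ x in (-1 : ℝ)..1, F (n - (s + 1)) x * G (s + 1) x := by
    intro s hs
    have h1 : n - (s + 1) = n - 1 - s := by omega
    have h2 : n - s = n - 1 - s + 1 := by omega
    rw [h1, h2]
    have ibp := AbsolutelyContinuousOnInterval.integral_mul_deriv_eq_deriv_mul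
      (hF.absCont (n - 1 - s) (by omega)) (hG.absCont s hs)
    rw [← integral_deriv_congr (hG.hasDerivAt s hs) (by norm_num) le_rfl] at ibp
    have h3 : ∫ x in (-1 : ℝ)..1, F (n - 1 - s + 1) x * G s x =
        ∫ x in (-1 : ℝ)..1, deriv (F (n - 1 - s)) x * G s x := by
      simp only [mul_comm _ (G s _)]
      exact integral_deriv_congr (hF.hasDerivAt (n - 1 - s) (by omega)) (by norm_num) le_rfl
    rw [h3, ibp]
    ring
  rw [Finset.sum_congr rfl fun s hs => key s (Finset.mem_range.1 hs),
    Finset.sum_range_sub' (fun s => (-1 : ℝ) ^ s * ∫ x in (-1 : ℝ)..1, F (n - s) x * G s x)]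
  simp

/-- Since `f` is the integral of `f'` from `-1`, Cauchy–Schwarz against `1` bounds `|f|` by `√2
‖f'‖`; integrating the square over length `2` gives the other factor `√2`. -/
lemma norm2_le_two_mul {f f' : ℝ → ℝ} (hf : AbsolutelyContinuousOnInterval f (-1) 1)
    (hd : ∀ᵐ x : ℝ, x ∈ Ioo (-1 : ℝ) 1 → HasDerivAt f (f' x) x) (h0 : f (-1) = 0)
    (hf' : SqIntegrable f') : norm2 f ≤ 2 * norm2 f' := by
  have hpt : ∀ x ∈ I, |f x| ≤ √2 * norm2 f' := by
    intro x hx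
    have hsub : uIcc (-1) x ⊆ uIcc (-1 : ℝ) 1 := by
      rw [uIcc_of_le hx.1, uIcc_of_le (by norm_num)]
      exact Icc_subset_Icc_right hx.2
    have h1 := (hf.mono hsub).integral_deriv_eq_sub
    have h2 := integral_deriv_congr (g := fun _ => 1) hd hx.1 hx.2
    simp only [one_mul] at h2
    rw [← h2, h0, sub_zero] at h1
    have hone : SqIntegrable fun _ => (1 : ℝ) := sqIntegrable_of_continuousOn continuousOn_const
    have hint : IntervalIntegrable (fun x => |f' x|) volume (-1) 1 := by
      have := (hone.intervalIntegrable_mul hf'.abs)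
      simpa using this
    have h3 : |∫ t in (-1 : ℝ)..x, f' t| ≤ ∫ t in (-1 : ℝ)..x, |f' t| :=
      intervalIntegral.abs_integral_le_integral_abs hx.1
    have h4 : ∫ t in (-1 : ℝ)..x, |f' t| ≤ ∫ t in (-1 : ℝ)..1, |f' t| :=
      intervalIntegral.integral_mono_interval le_rfl hx.1 hx.2
        (Eventually.of_forall fun t => abs_nonneg _) hint
    have h5 := abs_integral_mul_le hone hf'.abs
    have h6 : norm2 (fun _ => (1 : ℝ)) = √2 := by
      rw [norm2]; norm_num
    have h7 : norm2 (fun x => |f' x|) = norm2 f' := by simp only [norm2, abs_abs]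
    simp only [one_mul] at h5
    rw [h6, show norm2 |f'| = norm2 f' from h7] at h5
    rw [← h1]
    exact (h3.trans h4).trans ((le_abs_self _).trans h5)
  have hcont : ContinuousOn f I := uIcc_eq_I ▸ hf.continuousOn
  refine le_of_sq_le_sq ?_ (by have := norm2_nonneg f'; positivity)
  rw [norm2_sq]
  calc ∫ x in (-1 : ℝ)..1, f x * f x ≤ ∫ x in (-1 : ℝ)..1, 2 * norm2 f' ^ 2 := by
        refine intervalIntegral.integral_mono_on (by norm_num)
          ((sqIntegrable_of_continuousOn hcont).intervalIntegrable_mul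
            (sqIntegrable_of_continuousOn hcont)) (by simp) fun x hx => ?_
        have h := pow_le_pow_left₀ (abs_nonneg _) (hpt x hx) 2
        rw [sq_abs, mul_pow, Real.sq_sqrt (by norm_num)] at h
        linarith [sq (f x)]
    _ = (2 * norm2 f') ^ 2 := by
        rw [intervalIntegral.integral_const, smul_eq_mul]; ring

/-- A Poincaré inequality. -/
lemma IsDerivChain.norm2_le {n : ℕ} {F : ℕ → ℝ → ℝ} (hF : IsDerivChain n F)
    (h0 : ∀ i < n, F i (-1) = 0) (hn : SqIntegrable (F n)) :
    norm2 (F 0) ≤ 2 ^ n * norm2 (F n) := by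
  induction n with
  | zero => simp
  | succ n ih =>
    have h1 := ih (hF.mono n.le_succ) (fun i hi => h0 i (by omega))
      (sqIntegrable_of_continuousOn (hF.continuousOn n.lt_succ_self))
    have h2 := norm2_le_two_mul (hF.absCont n n.lt_succ_self) (hF.hasDerivAt n n.lt_succ_self)
      (h0 n n.lt_succ_self) hn
    calc norm2 (F 0) ≤ 2 ^ n * (2 * norm2 (F (n + 1))) := h1.trans (by gcongr)
      _ = _ := by ring

lemma eqOn_zero_of_norm2_eq_zero {f : ℝ → ℝ} (hf : ContinuousOn f I) (h : norm2 f = 0) :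
    EqOn f 0 I := by
  have h1 : ∫ x in (-1 : ℝ)..1, f x * f x = 0 := by rw [← norm2_sq, h]; norm_num
  have hc : ContinuousOn (fun x => f x * f x) (Icc (-1) 1) := hf.mul hf
  intro x hx
  by_contra hne
  have := intervalIntegral.integral_pos (by norm_num : (-1 : ℝ) < 1) hc
    (fun y _ => mul_self_nonneg _) ⟨x, hx, mul_self_pos.2 hne⟩
  exact this.ne' h1

/-- The energy estimate for `(-1)^r w^{(2r)} + λ w = h` with zero boundary values. -/
lemma IsDerivChain.energy_estimate {r : ℕ} (hr : 1 ≤ r) {w : ℕ → ℝ → ℝ} {h : ℝ → ℝ} {lam : ℝ}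
    (hlam : 0 ≤ lam) (hw : IsDerivChain (2 * r) w) (hh : ContinuousOn h I)
    (heq : ∀ x ∈ Ioo (-1 : ℝ) 1, (-1) ^ r * w (2 * r) x + lam * w 0 x = h x)
    (hl : ∀ s < r, w s (-1) = 0) (hr1 : ∀ s < r, w s 1 = 0) :
    norm2 (w r) ≤ 2 ^ r * norm2 h ∧ norm2 (w 0) ≤ 4 ^ r * norm2 h := by
  have hw' : IsDerivChain r fun i => w (r + i) := IsDerivChain.shift (by rwa [← two_mul])
  have hg := hw'.integral_mul_sub (hw.mono (by omega : r ≤ 2 * r))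
  rw [Finset.sum_eq_zero (fun s hs => by
    rw [hl s (Finset.mem_range.1 hs), hr1 s (Finset.mem_range.1 hs)]; ring)] at hg
  simp only [add_zero, ← two_mul] at hg
  have hc0 : SqIntegrable (w 0) := sqIntegrable_of_continuousOn (hw.continuousOn (by omega))
  have hcr : SqIntegrable (w r) := sqIntegrable_of_continuousOn (hw.continuousOn (by omega))
  have hch : SqIntegrable h := sqIntegrable_of_continuousOn hh
  have hsgn : ((-1 : ℝ) ^ r) * (-1) ^ r = 1 := by rw [← mul_pow]; norm_num
  have h1 : ∫ x in (-1 : ℝ)..1, w (2 * r) x * w 0 x =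
      (-1) ^ r * ((∫ x in (-1 : ℝ)..1, h x * w 0 x) - lam * ∫ x in (-1 : ℝ)..1, w 0 x * w 0 x) := by
    rw [← intervalIntegral.integral_const_mul, ← intervalIntegral.integral_sub
      (hch.intervalIntegrable_mul hc0) ((hc0.intervalIntegrable_mul hc0).const_mul _),
      ← intervalIntegral.integral_const_mul]
    refine integral_congr_Ioo fun x hx => ?_
    have := heq x hx
    rw [← this]
    linear_combination -(w (2 * r) x * w 0 x) * hsgn
  rw [h1, ← norm2_sq, ← norm2_sq, ← mul_sub, mul_eq_zero] at hg
  -- The energy identity: the equation paired with `w`.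
  have h2 : norm2 (w r) ^ 2 + lam * norm2 (w 0) ^ 2 = ∫ x in (-1 : ℝ)..1, h x * w 0 x := by
    rcases hg with hg | hg
    · exact absurd hg (by positivity)
    · linarith
  have h3 := (le_abs_self _).trans (abs_integral_mul_le hch hc0)
  have hp := (hw.mono (by omega : r ≤ 2 * r)).norm2_le hl hcr
  have hn := norm2_nonneg (w r)
  have hn0 := norm2_nonneg (w 0)
  have hnh := norm2_nonneg h
  -- The term with `λ` is dropped by its sign, so the constants do not depend on `λ`; Poincaré
  -- bounds `‖w‖` by `‖w^{(r)}‖`.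
  have h4 : norm2 (w r) * norm2 (w r) ≤ (2 ^ r * norm2 h) * norm2 (w r) := by
    have : norm2 h * norm2 (w 0) ≤ norm2 h * (2 ^ r * norm2 (w r)) := by gcongr
    have : 0 ≤ lam * norm2 (w 0) ^ 2 := by positivity
    nlinarith
  have h5 : norm2 (w r) ≤ 2 ^ r * norm2 h := by
    rcases hn.eq_or_lt with h0 | h0
    · rw [← h0]; positivity
    · exact le_of_mul_le_mul_right h4 h0
  refine ⟨h5, hp.trans ?_⟩
  calc (2 : ℝ) ^ r * norm2 (w r) ≤ 2 ^ r * (2 ^ r * norm2 h) := by gcongr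
    _ = 4 ^ r * norm2 h := by rw [← mul_assoc, ← mul_pow]; norm_num

/-! ### Iterated derivatives on `[-1, 1]` and the classes `L_2^n` -/

lemma D_succ_eq_deriv (n : ℕ) (f : ℝ → ℝ) {x : ℝ} (hx : x ∈ Ioo (-1 : ℝ) 1) :
    D (n + 1) f x = deriv (D n f) x := by
  rw [D, iteratedDerivWithin_succ]
  exact derivWithin_of_mem_nhds (Icc_mem_nhds hx.1 hx.2)

lemma D_zero (f : ℝ → ℝ) : D 0 f = f := by
  rw [D, iteratedDerivWithin_zero]

lemma D_congr {f g : ℝ → ℝ} (h : EqOn f g I) (n : ℕ) : EqOn (D n f) (D n g) I :=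
  iteratedDerivWithin_congr h

lemma D_eq_iteratedDeriv {f : ℝ → ℝ} (hf : ContDiff ℝ ∞ f) (n : ℕ) :
    EqOn (D n f) (iteratedDeriv n f) I := fun _ hx =>
  iteratedDerivWithin_eq_iteratedDeriv uniqueDiffOn_I
    (hf.contDiffAt.of_le (by exact_mod_cast le_top)) hx

lemma MemL2.absolutelyContinuous_D {n : ℕ} {f : ℝ → ℝ} (hf : MemL2 n f) {i : ℕ} (hi : i < n) :
    AbsolutelyContinuousOnInterval (D i f) (-1) 1 := by
  rcases Nat.lt_or_ge i (n - 1) with h | h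
  · refine ContDiffOn.absolutelyContinuousOnInterval ?_
    rw [uIcc_eq_I]
    have := (contDiffOn_nat_iff_continuousOn_differentiableOn_deriv uniqueDiffOn_I).1
      hf.contDiffOn
    rw [show (1 : WithTop ℕ∞) = ((1 : ℕ) : WithTop ℕ∞) by norm_cast,
      contDiffOn_nat_iff_continuousOn_differentiableOn_deriv uniqueDiffOn_I]
    refine ⟨fun m hm => ?_, fun m hm => ?_⟩
    · interval_cases m
      · simpa [D] using this.1 i (by omega)
      · rw [iteratedDerivWithin_one, D, ← iteratedDerivWithin_succ]
        exact this.1 (i + 1) (by omega)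
    · interval_cases m
      simpa [D] using this.2 i (by omega)
  · obtain rfl : i = n - 1 := by omega
    exact hf.absCont

lemma MemL2.isDerivChain {n : ℕ} {f : ℝ → ℝ} (hf : MemL2 n f) :
    IsDerivChain n fun i => D i f := by
  refine ⟨fun i hi => hf.absolutelyContinuous_D hi, fun i hi => ?_⟩
  filter_upwards [(hf.absolutelyContinuous_D hi).ae_differentiableAt] with x h hx
  rw [D_succ_eq_deriv i f hx]
  exact (h (by rw [uIcc_eq_I]; exact Ioo_subset_Icc_self hx)).hasDerivAt

lemma MemL2.continuousOn_D {n : ℕ} {f : ℝ → ℝ} (hf : MemL2 n f) {i : ℕ} (hi : i < n) :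
    ContinuousOn (D i f) I := hf.isDerivChain.continuousOn hi

lemma MemL2.sqIntegrable {n : ℕ} {f : ℝ → ℝ} (hf : MemL2 n f) (hn : 1 ≤ n) : SqIntegrable f := by
  have := sqIntegrable_of_continuousOn (hf.continuousOn_D hn)
  rwa [D_zero] at this

lemma contDiff_iteratedDeriv {f : ℝ → ℝ} (hf : ContDiff ℝ ∞ f) (n : ℕ) :
    ContDiff ℝ ∞ (iteratedDeriv n f) := by
  induction n with
  | zero => simpa using hf
  | succ n ih => rw [iteratedDeriv_succ]; exact (contDiff_infty_iff_deriv.1 ih).2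

lemma iteratedDeriv_iteratedDeriv (m n : ℕ) (f : ℝ → ℝ) :
    iteratedDeriv m (iteratedDeriv n f) = iteratedDeriv (m + n) f := by
  rw [iteratedDeriv_eq_iterate, iteratedDeriv_eq_iterate, iteratedDeriv_eq_iterate,
    Function.iterate_add_apply]

lemma continuousOn_D {f : ℝ → ℝ} (hf : ContDiff ℝ ∞ f) (n : ℕ) : ContinuousOn (D n f) I :=
  ((contDiff_iteratedDeriv hf n).continuous.continuousOn).congr (D_eq_iteratedDeriv hf n)

lemma memL2_of_contDiff {f : ℝ → ℝ} (hf : ContDiff ℝ ∞ f) (n : ℕ) : MemL2 n f where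
  contDiffOn := (contDiff_infty.1 hf _).contDiffOn
  absCont := by
    refine ContDiffOn.absolutelyContinuousOnInterval ?_
    rw [uIcc_eq_I]
    exact ((contDiff_iteratedDeriv hf _).of_le (by exact_mod_cast le_top)).contDiffOn.congr
      (D_eq_iteratedDeriv hf _)
  memLp := sqIntegrable_of_continuousOn (continuousOn_D hf n)

lemma D_iteratedDeriv {f : ℝ → ℝ} (hf : ContDiff ℝ ∞ f) (m n : ℕ) :
    EqOn (D m (iteratedDeriv n f)) (D (m + n) f) I := fun x hx => by
  rw [D_eq_iteratedDeriv (contDiff_iteratedDeriv hf n) m hx, D_eq_iteratedDeriv hf _ hx,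
    iteratedDeriv_iteratedDeriv]

/-! ### Solvability of the boundary value problem -/

/-- The companion operator of the equation `u^{(n)} = c u`. -/
noncomputable def companion (n : ℕ) (c : ℝ) : (Fin n → ℝ) →L[ℝ] (Fin n → ℝ) :=
  LinearMap.toContinuousLinearMap
    { toFun := fun v i => if h : i.1 + 1 < n then v ⟨i.1 + 1, h⟩ else c * v ⟨0, i.pos⟩
      map_add' := fun v w => by
        ext i
        by_cases h : i.1 + 1 < n <;> simp [h, mul_add]
      map_smul' := fun a v => by
        ext i
        by_cases h : i.1 + 1 < n <;> simp [h, mul_left_comm] }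

/-- The solution of the system `y' = A y` with `A` the companion operator and `y(-1) = v`. -/
noncomputable def flow (n : ℕ) (c : ℝ) (v : Fin n → ℝ) (x : ℝ) : Fin n → ℝ :=
  NormedSpace.exp ((x + 1) • companion n c) v

lemma hasDerivAt_flow (n : ℕ) (c : ℝ) (v : Fin n → ℝ) (x : ℝ) :
    HasDerivAt (flow n c v) (companion n c (flow n c v x)) x := by
  have h := (hasDerivAt_exp_smul_const' (𝕂 := ℝ) (companion n c) (x + 1)).comp_add_const x 1
  exact h.clm_apply (hasDerivAt_const x v) |>.congr_deriv (by simp [flow])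

lemma contDiff_flow (n : ℕ) (c : ℝ) (v : Fin n → ℝ) : ContDiff ℝ ∞ (flow n c v) := by
  rw [contDiff_infty]
  intro m
  induction m with
  | zero =>
    exact contDiff_zero.2 (continuous_iff_continuousAt.2 fun x =>
      (hasDerivAt_flow n c v x).continuousAt)
  | succ m ih =>
    have hd : deriv (flow n c v) = fun x => companion n c (flow n c v x) :=
      funext fun x => (hasDerivAt_flow n c v x).deriv
    push_cast
    rw [contDiff_succ_iff_deriv]
    refine ⟨fun x => (hasDerivAt_flow n c v x).differentiableAt, by simp, ?_⟩
    rw [hd]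
    exact (companion n c).contDiff.comp ih

lemma flow_neg_one (n : ℕ) (c : ℝ) (v : Fin n → ℝ) : flow n c v (-1) = v := by
  simp [flow]

lemma contDiff_flow_apply (n : ℕ) (c : ℝ) (v : Fin n → ℝ) (i : Fin n) :
    ContDiff ℝ ∞ (fun x => flow n c v x i) :=
  contDiff_pi.1 (contDiff_flow n c v) i

lemma iteratedDeriv_flow {n : ℕ} (c : ℝ) (v : Fin n → ℝ) (i : ℕ) (hi : i < n) :
    iteratedDeriv i (fun x => flow n c v x ⟨0, by omega⟩) = fun x => flow n c v x ⟨i, hi⟩ := by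
  induction i with
  | zero => simp
  | succ i ih =>
    rw [iteratedDeriv_succ, ih (by omega)]
    funext x
    have h := (hasDerivAt_pi.1 (hasDerivAt_flow n c v x) ⟨i, by omega⟩).deriv
    rw [h]
    simp [companion, hi]

lemma iteratedDeriv_flow_self {n : ℕ} (hn : 0 < n) (c : ℝ) (v : Fin n → ℝ) :
    iteratedDeriv n (fun x => flow n c v x ⟨0, hn⟩) = fun x => c * flow n c v x ⟨0, hn⟩ := by
  obtain ⟨m, rfl⟩ : ∃ m, n = m + 1 := ⟨n - 1, by omega⟩
  rw [iteratedDeriv_succ, iteratedDeriv_flow c v m (by omega)]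
  funext x
  have h := (hasDerivAt_pi.1 (hasDerivAt_flow (m + 1) c v x) ⟨m, by omega⟩).deriv
  rw [h]
  simp [companion]

/-- The boundary value problem is solvable for all boundary values. -/
lemma exists_solution {r : ℕ} (hr : 1 ≤ r) {lam : ℝ} (hlam : 0 ≤ lam) (a b : ℕ → ℝ) :
    ∃ u : ℝ → ℝ, ContDiff ℝ ∞ u ∧
      (∀ x, (-1) ^ r * iteratedDeriv (2 * r) u x + lam * u x = 0) ∧
      (∀ s < r, iteratedDeriv s u (-1) = a s) ∧ ∀ s < r, iteratedDeriv s u 1 = b s := by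
  have hsgn : ((-1 : ℝ) ^ r) * (-1) ^ r = 1 := by rw [← mul_pow]; norm_num
  set c : ℝ := -((-1) ^ r * lam) with hc
  have hn : 0 < 2 * r := by omega
  set U : (Fin (2 * r) → ℝ) → ℝ → ℝ := fun v x => flow (2 * r) c v x ⟨0, hn⟩ with hU
  have hsm : ∀ v, ContDiff ℝ ∞ (U v) := fun v => contDiff_flow_apply _ _ _ _
  have heq : ∀ v x, (-1) ^ r * iteratedDeriv (2 * r) (U v) x + lam * U v x = 0 := by
    intro v x
    have h := congrFun (iteratedDeriv_flow_self hn c v) x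
    simp only [hU]
    linear_combination (-1) ^ r * h + (-1) ^ r * flow (2 * r) c v x ⟨0, hn⟩ * hc -
      lam * flow (2 * r) c v x ⟨0, hn⟩ * hsgn
  -- Shooting: `L` sends the full initial data at `-1` to the boundary data at both ends. Domain and
  -- target have the same finite dimension, so solvability reduces to injectivity, which is the
  -- energy estimate with zero right-hand side.
  let L : (Fin (2 * r) → ℝ) →ₗ[ℝ] (Fin (2 * r) → ℝ) :=
    { toFun := fun v i => if i.1 < r then v i
        else flow (2 * r) c v 1 ⟨i.1 - r, by omega⟩
      map_add' := fun v w => by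
        ext i
        by_cases h : i.1 < r <;> simp [h, flow]
      map_smul' := fun a v => by
        ext i
        by_cases h : i.1 < r <;> simp [h, flow] }
  have hL1 : ∀ v, ∀ s < r, ∀ h : s < 2 * r, L v ⟨s, h⟩ = iteratedDeriv s (U v) (-1) := by
    intro v s hs h
    rw [hU, iteratedDeriv_flow c v s h]
    simp [L, hs, flow_neg_one]
  have hL2 : ∀ v, ∀ s < r, ∀ h : s + r < 2 * r, L v ⟨s + r, h⟩ = iteratedDeriv s (U v) 1 := by
    intro v s hs h
    rw [hU, iteratedDeriv_flow c v s (by omega)]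
    simp [L]
  have hinj : Function.Injective L := by
    rw [← LinearMap.ker_eq_bot, LinearMap.ker_eq_bot']
    intro v hv
    have hm := memL2_of_contDiff (hsm v) (2 * r)
    have hest := hm.isDerivChain.energy_estimate hr hlam (h := fun _ => 0) continuousOn_const
      (fun x hx => by
        rw [D_eq_iteratedDeriv (hsm v) _ (Ioo_subset_Icc_self hx), D_zero]
        exact heq v x)
      (fun s hs => by
        rw [D_eq_iteratedDeriv (hsm v) _ neg_one_mem_I, ← hL1 v s hs (by omega), hv]; rfl)
      (fun s hs => by
        rw [D_eq_iteratedDeriv (hsm v) _ one_mem_I, ← hL2 v s hs (by omega), hv]; rfl)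
    have h0 : norm2 (fun _ => (0 : ℝ)) = 0 := by simp [norm2]
    have h1 : norm2 (U v) = 0 := by
      have := hest.2
      rw [D_zero, h0, mul_zero] at this
      exact le_antisymm this (norm2_nonneg _)
    have h2 := eqOn_zero_of_norm2_eq_zero (hsm v).continuous.continuousOn h1
    ext ⟨i, hi⟩
    have h3 := D_congr h2 i neg_one_mem_I
    rw [D_eq_iteratedDeriv (hsm v) _ neg_one_mem_I,
      D_eq_iteratedDeriv (by exact contDiff_const (c := (0 : ℝ))) _ neg_one_mem_I, hU,
      iteratedDeriv_flow c v i hi] at h3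
    simpa [flow_neg_one, Pi.zero_def] using h3
  obtain ⟨v, hv⟩ := LinearMap.injective_iff_surjective.1 hinj
    fun i => if i.1 < r then a i.1 else b (i.1 - r)
  refine ⟨U v, hsm v, heq v, fun s hs => ?_, fun s hs => ?_⟩
  · rw [← hL1 v s hs (by omega), hv]; simp [hs]
  · rw [← hL2 v s hs (by omega), hv]; simp

lemma neg_one_pow_mul_self (r : ℕ) : ((-1 : ℝ) ^ r) * (-1) ^ r = 1 := by
  rw [← mul_pow]; norm_num

lemma exists_isSol {r : ℕ} (hr : 1 ≤ r) (k : ℕ) {lam : ℝ} (hlam : 0 ≤ lam) :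
    ∃ u : ℝ → ℝ, ContDiff ℝ ∞ u ∧ IsSol r k lam u := by
  obtain ⟨u, hu, heq, hl, hr1⟩ := exists_solution hr hlam
    (fun s => if s + k + 1 = r then (-1) ^ (k + 1) else 0) (fun _ => 0)
  refine ⟨u, hu, memL2_of_contDiff hu _, fun x hx => ?_, fun s hs => ?_, fun s hs => ?_⟩
  · rw [D_eq_iteratedDeriv hu _ (Ioo_subset_Icc_self hx)]
    exact heq x
  · rw [D_eq_iteratedDeriv hu _ neg_one_mem_I, hl s hs]
  · rw [D_eq_iteratedDeriv hu _ one_mem_I, hr1 s hs]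

/-! ### Uniqueness and dependence on `λ` -/

lemma norm2_le_add {f g : ℝ → ℝ} (hf : SqIntegrable f) (hg : SqIntegrable g) :
    norm2 f ≤ norm2 g + norm2 (fun x => f x - g x) := by
  have hfg : SqIntegrable fun x => f x - g x := hf.sub hg
  have h1 : ∫ x in (-1 : ℝ)..1, f x * f x =
      (∫ x in (-1 : ℝ)..1, f x * g x) + ∫ x in (-1 : ℝ)..1, f x * (f x - g x) := by
    rw [← intervalIntegral.integral_add (hf.intervalIntegrable_mul hg)
      (hf.intervalIntegrable_mul hfg)]
    exact integral_congr_I fun x _ => by ring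
  have h2 := (le_abs_self _).trans (abs_integral_mul_le hf hg)
  have h3 := (le_abs_self _).trans (abs_integral_mul_le hf hfg)
  rw [← norm2_sq] at h1
  rcases (norm2_nonneg f).eq_or_lt with h0 | h0
  · rw [← h0]; exact add_nonneg (norm2_nonneg _) (norm2_nonneg _)
  · refine le_of_mul_le_mul_left ?_ h0
    nlinarith

lemma abs_norm2_sub_le {f g : ℝ → ℝ} (hf : SqIntegrable f) (hg : SqIntegrable g) :
    |norm2 f - norm2 g| ≤ norm2 (fun x => f x - g x) := by
  have h1 := norm2_le_add hf hg
  have h2 := norm2_le_add hg hf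
  have h3 : norm2 (fun x => g x - f x) = norm2 (fun x => f x - g x) := by
    simp only [norm2, abs_sub_comm]
  rw [abs_le]
  constructor <;> linarith

section
variable {r k : ℕ} {lam mu : ℝ} {u v : ℝ → ℝ}

/-- The difference `w = v - u` has zero boundary data and satisfies `(-1)^r w^{(2r)} + lam w = (mu -
lam) u`, so the energy estimate applies. Taking `mu = lam` gives uniqueness; fixing `mu` and `u`
gives continuity at `mu`. -/
lemma IsSol.sub_estimate (hr : 1 ≤ r) (hlam : 0 ≤ lam) (hv : IsSol r k lam v)
    (hu : IsSol r k mu u) :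
    norm2 (fun x => D r v x - D r u x) ≤ 2 ^ r * (|mu - lam| * norm2 u) ∧
      norm2 (fun x => v x - u x) ≤ 4 ^ r * (|mu - lam| * norm2 u) := by
  have hc := hu.mem.continuousOn_D (i := 0) (by omega)
  rw [D_zero] at hc
  have h := (hv.mem.isDerivChain.sub hu.mem.isDerivChain).energy_estimate hr hlam
    (h := fun x => (mu - lam) * u x) (continuousOn_const.mul hc)
    (fun x hx => by
      have h1 := hv.eqn x hx
      have h2 := hu.eqn x hx
      simp only [D_zero]
      linear_combination h1 - h2)
    (fun s hs => by simp only [hv.left s hs, hu.left s hs, sub_self])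
    (fun s hs => by simp only [hv.right s hs, hu.right s hs, sub_self])
  simpa only [norm2_const_mul, D_zero] using h

lemma IsSol.eqOn (hr : 1 ≤ r) (hlam : 0 ≤ lam) (hv : IsSol r k lam v) (hu : IsSol r k lam u) :
    EqOn v u I := by
  have h := (hv.sub_estimate hr hlam hu).2
  rw [sub_self, abs_zero, zero_mul, mul_zero] at h
  have hcu := hu.mem.continuousOn_D (i := 0) (by omega)
  have hcv := hv.mem.continuousOn_D (i := 0) (by omega)
  rw [D_zero] at hcu hcv
  intro x hx
  exact sub_eq_zero.1 (eqOn_zero_of_norm2_eq_zero (hcv.sub hcu) (le_antisymm h (norm2_nonneg _)) hx)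

lemma IsSol.sqIntegrable_D (hr : 1 ≤ r) (hu : IsSol r k lam u) : SqIntegrable (D r u) :=
  sqIntegrable_of_continuousOn (hu.mem.continuousOn_D (by omega))

lemma IsSol.sqIntegrable (hr : 1 ≤ r) (hu : IsSol r k lam u) : SqIntegrable u :=
  hu.mem.sqIntegrable (by omega)

/-! ### The representation formula and its extremal function -/

/-- The representation of `f^{(k)}(-1)` by means of a solution. -/
lemma IsSol.representation (hk : k < r) (hu : IsSol r k lam u) {f : ℝ → ℝ}
    (hf : MemL2 r f) :
    D k f (-1) = (∫ x in (-1 : ℝ)..1, f x * D r u x) -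
      (-1) ^ r * ∫ x in (-1 : ℝ)..1, D r f x * u x := by
  have h := hf.isDerivChain.integral_mul_sub (hu.mem.isDerivChain.mono (by omega : r ≤ 2 * r))
  -- Only `s = r - 1 - k` has nonzero boundary data, and it is paired with the derivative of `f` of
  -- order `k`.
  rw [Finset.sum_eq_single (r - 1 - k)] at h
  · rw [hu.right _ (by omega), hu.left _ (by omega), if_pos (by omega),
      show r - 1 - (r - 1 - k) = k by omega] at h
    have h2 : (-1 : ℝ) ^ (r - 1 - k) * (-1) ^ (k + 1) = (-1) ^ r := by
      rw [← pow_add]; congr 1; omega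
    simp only [D_zero] at h
    have hs := neg_one_pow_mul_self r
    linear_combination (-1) ^ r * h +
      ((∫ x in (-1 : ℝ)..1, f x * D r u x) - D k f (-1)) * hs - (-1) ^ r * D k f (-1) * h2
  · intro s hs hne
    have hs' := Finset.mem_range.1 hs
    rw [hu.right s hs', hu.left s hs', if_neg (by omega)]
    ring
  · intro hs
    exact absurd (Finset.mem_range.2 (by omega)) hs

lemma IsSol.abs_le (hr : 1 ≤ r) (hk : k < r) (hu : IsSol r k lam u) {f : ℝ → ℝ}
    (hf : MemL2 r f) : |D k f (-1)| ≤ norm2 (D r u) * norm2 f + norm2 u * norm2 (D r f) := by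
  rw [hu.representation hk hf]
  have h1 := abs_integral_mul_le (hf.sqIntegrable hr) (hu.sqIntegrable_D hr)
  have h2 := abs_integral_mul_le hf.memLp (hu.sqIntegrable hr)
  refine (abs_sub _ _).trans ?_
  rw [abs_mul, abs_pow, abs_neg, abs_one, one_pow, one_mul]
  linarith

/-- By the equation, `u^{(2r)} = -(-1)^r λ u`. This proportionality is what gives equality in
Cauchy–Schwarz. -/
lemma IsSol.norm2_D_iteratedDeriv (hsm : ContDiff ℝ ∞ u) (hlam : 0 ≤ lam)
    (hu : IsSol r k lam u) : norm2 (D r (iteratedDeriv r u)) = lam * norm2 u := by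
  rw [← abs_of_nonneg hlam, ← norm2_const_mul]
  simp only [norm2]
  congr 1
  refine integral_congr_Ioo fun x hx => ?_
  have h := hu.eqn x hx
  have hs := neg_one_pow_mul_self r
  simp only [sq_abs]
  rw [D_iteratedDeriv hsm r r (Ioo_subset_Icc_self hx), ← two_mul]
  linear_combination ((-1) ^ r * D (2 * r) u x - lam * u x) * h - D (2 * r) u x ^ 2 * hs

/-- The `r`-th derivative of the solution is extremal. -/
lemma IsSol.D_iteratedDeriv_neg_one (hk : k < r) (hsm : ContDiff ℝ ∞ u)
    (hu : IsSol r k lam u) :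
    D k (iteratedDeriv r u) (-1) = norm2 (D r u) ^ 2 + lam * norm2 u ^ 2 := by
  rw [hu.representation hk (memL2_of_contDiff (contDiff_iteratedDeriv hsm r) r), norm2_sq,
    norm2_sq, ← intervalIntegral.integral_const_mul, ← intervalIntegral.integral_const_mul,
    sub_eq_add_neg, ← intervalIntegral.integral_neg]
  congr 1
  · exact integral_congr_I fun x hx => by simp only [D_eq_iteratedDeriv hsm r hx]
  · refine integral_congr_Ioo fun x hx => ?_
    have h := hu.eqn x hx
    rw [D_iteratedDeriv hsm r r (Ioo_subset_Icc_self hx), ← two_mul]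
    linear_combination -u x * h

/-- The derivative of order `r - 1 - k` at `-1` is `±1`, which excludes the zero function. -/
lemma IsSol.norm2_pos (hk : k < r) (hu : IsSol r k lam u) : 0 < norm2 u := by
  refine (norm2_nonneg u).lt_of_ne' fun h => ?_
  have hc := hu.mem.continuousOn_D (i := 0) (by omega)
  rw [D_zero] at hc
  have h1 := D_congr (eqOn_zero_of_norm2_eq_zero hc h) (r - 1 - k) neg_one_mem_I
  rw [hu.left _ (by omega), if_pos (by omega), D_eq_iteratedDeriv
    (by exact contDiff_const (c := (0 : ℝ))) _ neg_one_mem_I] at h1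
  simp [Pi.zero_def] at h1

end

/-! ### Unboundedness of `‖u_λ^{(r)}‖` -/

/-- A smooth function with small norm that equals `(x + 1)^k` near `-1` and vanishes near `1`. -/
lemma exists_localized_monomial (k : ℕ) {ε : ℝ} (hε : 0 < ε) (hε1 : ε ≤ 1) :
    ∃ f : ℝ → ℝ, ContDiff ℝ ∞ f ∧ 1 ≤ D k f (-1) ∧ norm2 f ^ 2 ≤ ε ∧
      (∀ s, k < s → D s f (-1) = 0) ∧ ∀ s, D s f 1 = 0 := by
  let φ : ContDiffBump (-1 : ℝ) := ⟨ε / 2, ε, by positivity, by linarith⟩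
  set f : ℝ → ℝ := fun x => (x + 1) ^ k * φ x with hf
  have hsm : ContDiff ℝ ∞ f := ((contDiff_id.add contDiff_const).pow k).mul φ.contDiff
  have h1 : f =ᶠ[𝓝 (-1)] fun x => (x + 1) ^ k := by
    filter_upwards [φ.eventuallyEq_one] with x hx
    simp [hf, hx]
  have h2 : f =ᶠ[𝓝 1] fun _ => 0 := by
    filter_upwards [eventually_gt_nhds (zero_lt_one' ℝ)] with x hx
    have : φ x = 0 := φ.zero_of_le_dist (by
      rw [Real.dist_eq, abs_of_pos (by linarith)]; change ε ≤ _; linarith)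
    simp [hf, this]
  -- Near `-1` the cutoff is `1`, so the derivatives there are those of the monomial.
  have h3 : ∀ s, D s f (-1) = (k.descFactorial s : ℝ) * 0 ^ (k - s) := by
    intro s
    rw [D_eq_iteratedDeriv hsm s neg_one_mem_I, h1.iteratedDeriv_eq s]
    have := congrFun (iteratedDeriv_comp_add_const (n := s) (fun x : ℝ => x ^ k) (1 : ℝ)) (-1)
    simpa using this
  refine ⟨f, hsm, ?_, ?_, fun s hs => ?_, fun s => ?_⟩
  · rw [h3, Nat.descFactorial_self]
    simpa using Nat.one_le_iff_ne_zero.2 k.factorial_ne_zero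
  · rw [norm2_sq]
    have hint : ∀ a b : ℝ, IntervalIntegrable (fun x => f x * f x) volume a b := fun a b =>
      (hsm.continuous.mul hsm.continuous).intervalIntegrable a b
    rw [← intervalIntegral.integral_add_adjacent_intervals (hint (-1) (-1 + ε)) (hint _ 1)]
    have hz : ∫ x in (-1 + ε)..1, f x * f x = 0 := by
      rw [intervalIntegral.integral_congr (g := fun _ => 0), intervalIntegral.integral_zero]
      intro x hx
      rw [uIcc_of_le (by linarith)] at hx
      have : φ x = 0 := φ.zero_of_le_dist (by
        rw [Real.dist_eq, abs_of_nonneg (by linarith [hx.1])]; change ε ≤ _; linarith [hx.1])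
      simp [hf, this]
    have hb : ∫ x in (-1)..(-1 + ε), f x * f x ≤ ∫ x in (-1)..(-1 + ε), (1 : ℝ) := by
      refine intervalIntegral.integral_mono_on (by linarith) (hint _ _) (by simp) fun x hx => ?_
      have h4 : 0 ≤ x + 1 := by linarith [hx.1]
      have h5 : (x + 1) ^ k ≤ 1 := pow_le_one₀ h4 (by linarith [hx.2])
      have h6 : f x ≤ 1 := mul_le_one₀ h5 φ.nonneg φ.le_one
      have h7 : 0 ≤ f x := mul_nonneg (pow_nonneg h4 k) φ.nonneg
      exact mul_le_one₀ h6 h7 h6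
    rw [hz, add_zero]
    simpa using hb
  · rw [h3, Nat.descFactorial_eq_zero_iff_lt.2 hs]; simp
  · rw [D_eq_iteratedDeriv hsm s one_mem_I, h2.iteratedDeriv_eq s]; simp

/-- Multiply the representation by `λ`, replace `λ u` by `-(-1)^r u^{(2r)}` and move `r` derivatives
over to `f`, whose boundary terms vanish. This eliminates `‖u‖`, leaving a bound by `‖u^{(r)}‖`
alone. -/
lemma IsSol.localized_bound {r k : ℕ} (hr : 1 ≤ r) (hk : k < r) {lam : ℝ} (hlam : 0 ≤ lam)
    {u : ℝ → ℝ} (hu : IsSol r k lam u) {f : ℝ → ℝ} (hf : ContDiff ℝ ∞ f)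
    (hl : ∀ s, r ≤ s → D s f (-1) = 0) (hr1 : ∀ s, D s f 1 = 0) :
    lam * D k f (-1) ≤ (lam * norm2 f + norm2 (D (2 * r) f)) * norm2 (D r u) := by
  have hrep := hu.representation hk (memL2_of_contDiff hf r)
  have hcu : IsDerivChain (r + r) fun i => D i u := by
    rw [← two_mul]; exact hu.mem.isDerivChain
  have hg := hcu.shift.integral_mul_sub (memL2_of_contDiff hf (r + r)).isDerivChain.shift
  rw [Finset.sum_eq_zero (fun s _ => by rw [hl _ (by omega), hr1]; ring)] at hg
  simp only [add_zero, ← two_mul] at hg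
  have h1 : lam * ∫ x in (-1 : ℝ)..1, D r f x * u x =
      -((-1) ^ r * ∫ x in (-1 : ℝ)..1, D (2 * r) u x * D r f x) := by
    rw [← intervalIntegral.integral_const_mul, ← intervalIntegral.integral_const_mul,
      ← intervalIntegral.integral_neg]
    exact integral_congr_Ioo fun x hx => by
      have := hu.eqn x hx
      linear_combination D r f x * this
  have hs := neg_one_pow_mul_self r
  have h2 : lam * D k f (-1) = lam * (∫ x in (-1 : ℝ)..1, f x * D r u x) +
      (-1) ^ r * ∫ x in (-1 : ℝ)..1, D r u x * D (2 * r) f x := by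
    rw [hrep]
    linear_combination -(-1) ^ r * h1 + hg +
      (∫ x in (-1 : ℝ)..1, D (2 * r) u x * D r f x) * hs
  have h3 := (le_abs_self _).trans (abs_integral_mul_le
    (sqIntegrable_of_continuousOn hf.continuous.continuousOn) (hu.sqIntegrable_D hr))
  have h4 := abs_integral_mul_le (hu.sqIntegrable_D hr)
    (sqIntegrable_of_continuousOn (continuousOn_D hf (2 * r)))
  have h5 : (-1) ^ r * ∫ x in (-1 : ℝ)..1, D r u x * D (2 * r) f x ≤
      norm2 (D r u) * norm2 (D (2 * r) f) := by
    refine (le_abs_self _).trans ?_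
    rwa [abs_mul, abs_pow, abs_neg, abs_one, one_pow, one_mul]
  have h6 := mul_le_mul_of_nonneg_left h3 hlam
  rw [h2]
  linarith

/-- The norms `‖u_λ^{(r)}‖₂` are unbounded. -/
lemma exists_norm2_D_ge {r k : ℕ} (hr : 1 ≤ r) (hk : k < r) {C : ℝ} (hC : 1 ≤ C) :
    ∃ lam : ℝ, 0 ≤ lam ∧ ∀ u, IsSol r k lam u → C ≤ norm2 (D r u) := by
  -- This width makes `‖f‖ ≤ 1 / (2C)`.
  obtain ⟨f, hf, h1, h2, h3, h4⟩ := exists_localized_monomial k (ε := 1 / (2 * C) ^ 2)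
    (by positivity) (by
      rw [div_le_one (by positivity)]
      nlinarith)
  have hK := norm2_nonneg (D (2 * r) f)
  -- With `K = ‖f^{(2r)}‖`, the assumption `‖u^{(r)}‖ < C` would give `λ ≤ λ/2 + K C`, that is `λ ≤
  -- 2 K C`; this `λ` is larger by `1`.
  refine ⟨2 * (norm2 (D (2 * r) f) * C) + 1, by positivity, fun u hu => ?_⟩
  by_contra! hlt
  have hb := hu.localized_bound hr hk (by positivity) hf (fun s hs => h3 s (by omega)) h4
  have hA := norm2_nonneg (D r u)
  set K := norm2 (D (2 * r) f)
  set lam := 2 * (K * C) + 1 with hlam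
  have hlam0 : 0 ≤ lam := by positivity
  have hfn : norm2 f ≤ 1 / (2 * C) := by
    refine le_of_sq_le_sq ?_ (by positivity)
    rwa [div_pow, one_pow]
  have h5 : (lam * norm2 f + K) * norm2 (D r u) ≤ (lam * (1 / (2 * C)) + K) * C := by
    have := norm2_nonneg f
    gcongr
  have h6 : (lam * (1 / (2 * C)) + K) * C = lam / 2 + K * C := by field_simp
  have h7 : lam * 1 ≤ lam * D k f (-1) := by gcongr
  linarith

/-! ### Polynomials and the Markov–Nikolskii constant -/

/-- The Taylor polynomial of degree `r - 1` at `-1` has remainder bounded by the supremum of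
`|f^{(r)}|`, here `0`. -/
lemma exists_polynomial_eqOn {r : ℕ} (hr : 1 ≤ r) {f : ℝ → ℝ} (hf : ContDiff ℝ ∞ f)
    (h : EqOn (D r f) 0 I) :
    ∃ Q : Polynomial ℝ, Q.degree < (r : WithBot ℕ) ∧ EqOn f (fun x => Q.eval x) I := by
  obtain ⟨n, rfl⟩ : ∃ n, r = n + 1 := ⟨r - 1, by omega⟩
  refine ⟨∑ i ∈ Finset.range (n + 1), Polynomial.C ((i.factorial : ℝ)⁻¹ * D i f (-1)) *
    (Polynomial.X + Polynomial.C 1) ^ i, ?_, fun x hx => ?_⟩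
  · refine (Polynomial.degree_sum_le _ _).trans_lt ((Finset.sup_lt_iff ?_).2 fun i hi => ?_)
    · exact WithBot.bot_lt_coe _
    · refine (Polynomial.degree_mul_le _ _).trans_lt ?_
      rw [Polynomial.degree_pow, Polynomial.degree_X_add_C]
      refine (add_le_add_left Polynomial.degree_C_le _).trans_lt ?_
      rw [zero_add, nsmul_eq_mul, mul_one]
      exact_mod_cast Finset.mem_range.1 hi
  · have := taylor_mean_remainder_bound (C := 0) (n := n) (by norm_num : (-1 : ℝ) ≤ 1)
      ((hf.of_le (by exact_mod_cast le_top)).contDiffOn) hx (fun y hy => by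
        have := h hy
        rw [D, I] at this
        rw [this]; simp)
    rw [zero_mul, zero_div, norm_le_zero_iff, sub_eq_zero, taylor_within_apply] at this
    rw [this]
    simp only [Polynomial.eval_finsetSum]
    refine Finset.sum_congr rfl fun i _ => ?_
    simp only [smul_eq_mul, Polynomial.eval_mul, Polynomial.eval_C, Polynomial.eval_pow,
      Polynomial.eval_add, Polynomial.eval_X, sub_neg_eq_add]
    rw [D, I]
    ring

lemma contDiff_polynomial_eval (Q : Polynomial ℝ) : ContDiff ℝ ∞ fun x => Q.eval x := by
  simpa using Q.contDiff_aeval (𝕜 := ℝ) ∞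

lemma D_polynomial_eval (Q : Polynomial ℝ) (n : ℕ) :
    EqOn (D n fun x => Q.eval x) (fun x => (Polynomial.derivative^[n] Q).eval x) I := by
  intro x hx
  rw [D_eq_iteratedDeriv (contDiff_polynomial_eval Q) n hx]
  have : ∀ n, iteratedDeriv n (fun x => Q.eval x) =
      fun x => (Polynomial.derivative^[n] Q).eval x := by
    intro n
    induction n with
    | zero => simp
    | succ n ih =>
      rw [iteratedDeriv_succ, ih, Function.iterate_succ_apply']
      funext y
      exact Polynomial.deriv _
  rw [this]

section
variable {r k : ℕ} {lam : ℝ} {u : ℝ → ℝ}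

lemma IsSol.abs_polynomial_le (hr : 1 ≤ r) (hk : k < r) (hu : IsSol r k lam u)
    {Q : Polynomial ℝ} (hQ : Q.degree < (r : WithBot ℕ)) :
    |(Polynomial.derivative^[k] Q).eval (-1)| ≤ norm2 (D r u) * norm2 fun x => Q.eval x := by
  have h := hu.abs_le hr hk (memL2_of_contDiff (contDiff_polynomial_eval Q) r)
  have h0 : norm2 (D r fun x => Q.eval x) = 0 := by
    rw [norm2_congr (D_polynomial_eval Q r), Polynomial.iterate_derivative_eq_zero_of_degree_lt hQ]
    simp [norm2]
  rwa [h0, mul_zero, add_zero, D_polynomial_eval Q k neg_one_mem_I] at h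

/-- For `λ = 0` the equation reads `u^{(2r)} = 0`, so `Q = u^{(r)}` is a polynomial; it is the
extremal function. -/
lemma IsSol.exists_extremal_polynomial (hr : 1 ≤ r) (hk : k < r) (hsm : ContDiff ℝ ∞ u)
    (hu : IsSol r k 0 u) : ∃ Q : Polynomial ℝ, Q.degree < (r : WithBot ℕ) ∧
      norm2 (fun x => Q.eval x) = norm2 (D r u) ∧
      (Polynomial.derivative^[k] Q).eval (-1) = norm2 (D r u) ^ 2 := by
  have hsm' := contDiff_iteratedDeriv hsm r
  have hn := hu.norm2_D_iteratedDeriv hsm le_rfl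
  rw [zero_mul] at hn
  obtain ⟨Q, hQ, hQe⟩ := exists_polynomial_eqOn hr hsm'
    (eqOn_zero_of_norm2_eq_zero (continuousOn_D hsm' r) hn)
  refine ⟨Q, hQ, norm2_congr fun x hx => ?_, ?_⟩
  · rw [D_eq_iteratedDeriv hsm r hx, hQe hx]
  · have h := hu.D_iteratedDeriv_neg_one hk hsm
    rw [zero_mul, add_zero] at h
    rw [← h, D_congr hQe k neg_one_mem_I, D_polynomial_eval Q k neg_one_mem_I]

/-- A constant bounding `|Q^{(k)}(-1)| / ‖Q‖₂` is at least `‖u_0^{(r)}‖₂`. -/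
lemma IsSol.norm2_D_le_of_bound (hr : 1 ≤ r) (hk : k < r) (hsm : ContDiff ℝ ∞ u)
    (hu : IsSol r k 0 u) {A : ℝ} (hA : ∀ Q : Polynomial ℝ, Q.degree < (r : WithBot ℕ) →
      |(Polynomial.derivative^[k] Q).eval (-1)| ≤ A * norm2 fun x => Q.eval x) :
    norm2 (D r u) ≤ A := by
  obtain ⟨Q, hQ, hQn, hQe⟩ := hu.exists_extremal_polynomial hr hk hsm
  have h := hA Q hQ
  rw [hQe, hQn, abs_of_nonneg (by positivity), sq] at h
  rcases (norm2_nonneg (D r u)).eq_or_lt with h0 | h0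
  -- When `‖u^{(r)}‖ = 0` no division is possible; testing on `Q = 1` still gives `A ≥ 0`.
  · have h1 := (abs_nonneg _).trans (hA 1 (by
      rw [Polynomial.degree_one]; exact_mod_cast hr))
    have h2 : 0 < norm2 fun x => (1 : Polynomial ℝ).eval x := by
      simp only [norm2, Polynomial.eval_one]
      norm_num
    rw [← h0]
    exact nonneg_of_mul_nonneg_left h1 h2
  · exact le_of_mul_le_mul_right h h0

/-- The scaled extremal function shows that `‖u_λ‖₂` is at most the supremum of
`|f^{(k)}(-1)| - A ‖f‖₂` over `W_2^r` whenever `A ≤ ‖u_λ^{(r)}‖₂`. -/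
lemma IsSol.le_of_mem_upperBounds (hk : k < r) (hsm : ContDiff ℝ ∞ u) (hlam : 0 < lam)
    (hu : IsSol r k lam u) {A b : ℝ} (hA : A ≤ norm2 (D r u))
    (hb : b ∈ upperBounds ((fun f => |D k f (-1)| - A * norm2 f) '' W r)) : norm2 u ≤ b := by
  have hp := hu.norm2_pos hk
  have hsm' := contDiff_iteratedDeriv hsm r
  -- Normalises the `r`-th derivative of `c u^{(r)}` to norm `1`; this needs `λ > 0`.
  set c : ℝ := (lam * norm2 u)⁻¹ with hc
  have hc0 : 0 < c := by positivity
  set f : ℝ → ℝ := fun x => c * iteratedDeriv r u x with hf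
  have hfs : ContDiff ℝ ∞ f := contDiff_const.mul hsm'
  have hD : ∀ n, EqOn (D n f) (fun x => c * D n (iteratedDeriv r u) x) I := fun n x hx => by
    rw [D_eq_iteratedDeriv hfs n hx, hf, iteratedDeriv_const_mul_field,
      ← D_eq_iteratedDeriv hsm' n hx]
  have hW : f ∈ W r := by
    refine ⟨memL2_of_contDiff hfs r, ?_⟩
    rw [norm2_congr (hD r), norm2_const_mul, hu.norm2_D_iteratedDeriv hsm hlam.le,
      abs_of_pos hc0, hc, inv_mul_cancel₀ (by positivity)]
  have h := hb ⟨f, hW, rfl⟩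
  have hfn : norm2 f = c * norm2 (D r u) := by
    rw [hf, norm2_const_mul, abs_of_pos hc0, norm2_congr (D_eq_iteratedDeriv hsm r)]
  simp only [hfn] at h
  rw [hD k neg_one_mem_I] at h
  beta_reduce at h
  rw [hu.D_iteratedDeriv_neg_one hk hsm,
    abs_of_nonneg (by positivity)] at h
  have hcl : c * (lam * norm2 u) = 1 := inv_mul_cancel₀ (by positivity)
  -- The value at the extremal function exceeds `‖u‖` by a multiple of `‖u^{(r)}‖ - A`, whence the
  -- hypothesis on `A`.
  have h1 : c * (norm2 (D r u) ^ 2 + lam * norm2 u ^ 2) - A * (c * norm2 (D r u)) =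
      c * norm2 (D r u) * (norm2 (D r u) - A) + norm2 u := by
    linear_combination norm2 u * hcl
  have h2 : 0 ≤ c * norm2 (D r u) * (norm2 (D r u) - A) :=
    mul_nonneg (mul_nonneg hc0.le (norm2_nonneg _)) (sub_nonneg.2 hA)
  linarith

end

/-! ### Continuity in `λ` and the description of `Γ` -/

lemma continuousWithinAt_of_abs_sub_le {f : ℝ → ℝ} {K a : ℝ} {s : Set ℝ}
    (h : ∀ x ∈ s, |f x - f a| ≤ K * |a - x|) : ContinuousWithinAt f s a := by
  rw [ContinuousWithinAt, tendsto_iff_dist_tendsto_zero]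
  have h0 : Tendsto (fun x => K * |a - x|) (𝓝[s] a) (𝓝 0) := by
    have : Continuous fun x => K * |a - x| := by fun_prop
    simpa using this.continuousWithinAt (s := s) (x := a) |>.tendsto
  exact squeeze_zero' (Eventually.of_forall fun _ => dist_nonneg)
    (eventually_mem_nhdsWithin.mono fun x hx => h x hx) h0

section
variable {r k : ℕ} {u : ℝ → ℝ → ℝ}

lemma continuousOn_norm2_D (hr : 1 ≤ r) (hu : ∀ lam : ℝ, 0 ≤ lam → IsSol r k lam (u lam)) :
    ContinuousOn (fun lam => norm2 (D r (u lam))) (Ici 0) := fun a ha =>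
  continuousWithinAt_of_abs_sub_le (K := 2 ^ r * norm2 (u a)) fun x hx => by
    refine (abs_norm2_sub_le ((hu x hx).sqIntegrable_D hr) ((hu a ha).sqIntegrable_D hr)).trans ?_
    exact ((hu x hx).sub_estimate hr hx (hu a ha)).1.trans_eq (by ring)

lemma continuousOn_norm2 (hr : 1 ≤ r) (hu : ∀ lam : ℝ, 0 ≤ lam → IsSol r k lam (u lam)) :
    ContinuousOn (fun lam => norm2 (u lam)) (Ici 0) := fun a ha =>
  continuousWithinAt_of_abs_sub_le (K := 4 ^ r * norm2 (u a)) fun x hx => by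
    refine (abs_norm2_sub_le ((hu x hx).sqIntegrable hr) ((hu a ha).sqIntegrable hr)).trans ?_
    exact ((hu x hx).sub_estimate hr hx (hu a ha)).2.trans_eq (by ring)

lemma exists_norm2_D_eq (hr : 1 ≤ r) (hk : k < r)
    (hu : ∀ lam : ℝ, 0 ≤ lam → IsSol r k lam (u lam)) {A : ℝ} (hA : norm2 (D r (u 0)) ≤ A) :
    ∃ lam : ℝ, 0 ≤ lam ∧ A = norm2 (D r (u lam)) := by
  obtain ⟨mu, hmu, h⟩ := exists_norm2_D_ge (C := max A 1) hr hk (le_max_right _ _)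
  have hc := (continuousOn_norm2_D hr hu).mono (Icc_subset_Ici_self : Icc 0 mu ⊆ Ici 0)
  obtain ⟨lam, hlam, he⟩ := intermediate_value_Icc hmu hc
    ⟨hA, (le_max_left _ _).trans (h _ (hu mu hmu))⟩
  exact ⟨lam, hlam.1, he.symm⟩

/-- Every `‖u_λ^{(r)}‖` is an admissible constant for polynomials, and `‖u_0^{(r)}‖` is the least
one. -/
lemma norm2_D_zero_le (hr : 1 ≤ r) (hk : k < r) (hsm : ContDiff ℝ ∞ (u 0))
    (hu : ∀ lam : ℝ, 0 ≤ lam → IsSol r k lam (u lam)) {lam : ℝ} (hlam : 0 ≤ lam) :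
    norm2 (D r (u 0)) ≤ norm2 (D r (u lam)) :=
  (hu 0 le_rfl).norm2_D_le_of_bound hr hk hsm fun _ hQ =>
    (hu lam hlam).abs_polynomial_le hr hk hQ

lemma mem_Gam (hr : 1 ≤ r) (hk : k < r) (hsm : ∀ lam : ℝ, 0 ≤ lam → ContDiff ℝ ∞ (u lam))
    (hu : ∀ lam : ℝ, 0 ≤ lam → IsSol r k lam (u lam)) {lam : ℝ} (hlam : 0 ≤ lam) :
    (norm2 (D r (u lam)), norm2 (u lam)) ∈ Gam r k (-1) := by
  have hle := fun f (hf : MemL2 r f) => (hu lam hlam).abs_le hr hk hf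
  refine ⟨norm2_nonneg _, norm2_nonneg _, hle, ?_, fun b hb => ?_⟩
  · rintro _ ⟨f, ⟨hf, hf1⟩, rfl⟩
    have h := hle f hf
    have := mul_le_mul_of_nonneg_left hf1 (norm2_nonneg (u lam))
    simp only
    linarith
  -- At `λ = 0` the extremal function cannot be normalised. Instead, `‖u_0^{(r)}‖ ≤ ‖u_μ^{(r)}‖`
  -- shows that `b ≥ ‖u_μ‖` for all `μ > 0`, and `μ` tends to `0`.
  · rcases hlam.eq_or_lt with rfl | hpos
    · have hlim : Tendsto (fun mu => norm2 (u mu)) (𝓝[>] 0) (𝓝 (norm2 (u 0))) :=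
        (continuousOn_norm2 hr hu 0 self_mem_Ici).mono_left
          (nhdsWithin_mono _ Ioi_subset_Ici_self)
      refine le_of_tendsto hlim (eventually_mem_nhdsWithin.mono fun mu hmu => ?_)
      have hmu' : (0 : ℝ) ≤ mu := le_of_lt hmu
      exact (hu mu hmu').le_of_mem_upperBounds hk (hsm mu hmu') hmu
        (norm2_D_zero_le hr hk (hsm 0 le_rfl) hu hmu') hb
    · exact (hu lam hlam).le_of_mem_upperBounds hk (hsm lam hlam) hpos le_rfl hb

/-- On polynomials of degree less than `r` the term with `B` vanishes. -/
lemma norm2_D_le_of_mem_Gam (hr : 1 ≤ r) (hk : k < r) (hsm : ContDiff ℝ ∞ (u 0))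
    (hu : IsSol r k 0 (u 0)) {p : ℝ × ℝ} (hp : p ∈ Gam r k (-1)) :
    norm2 (D r (u 0)) ≤ p.1 := by
  refine hu.norm2_D_le_of_bound hr hk hsm fun Q hQ => ?_
  have h := hp.2.2.1 _ (memL2_of_contDiff (contDiff_polynomial_eval Q) r)
  have h0 : norm2 (D r fun x => Q.eval x) = 0 := by
    rw [norm2_congr (D_polynomial_eval Q r), Polynomial.iterate_derivative_eq_zero_of_degree_lt hQ]
    simp [norm2]
  rwa [h0, mul_zero, add_zero, D_polynomial_eval Q k neg_one_mem_I] at h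

end

end LandauKolmogorov

/-! ### The main theorem -/

theorem mainTheorem2 (r k : ℕ) (hr : 1 ≤ r) (hk : k ≤ r - 1) :
    ∃ (u : ℝ → ℝ → ℝ) (M : ℝ),
      (∀ lam : ℝ, 0 ≤ lam → LandauKolmogorov.IsSol r k lam (u lam) ∧
        ∀ v, LandauKolmogorov.IsSol r k lam v → Set.EqOn v (u lam) LandauKolmogorov.I) ∧
      LandauKolmogorov.Gam r k (-1) =
        {p | ∃ lam : ℝ, 0 ≤ lam ∧
          p = (LandauKolmogorov.norm2 (LandauKolmogorov.D r (u lam)),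
            LandauKolmogorov.norm2 (u lam))} ∧
      LandauKolmogorov.IsMarkovNikolskii r k (-1) M ∧
      LandauKolmogorov.norm2 (LandauKolmogorov.D r (u 0)) = M ∧
      {A | ∃ lam : ℝ, 0 ≤ lam ∧ A = LandauKolmogorov.norm2 (LandauKolmogorov.D r (u lam))} =
        Set.Ici M := by
  have hk' : k < r := by omega
  -- The family is indexed by all reals; negative parameters get the junk value `0`.
  have hex : ∀ lam : ℝ, ∃ u : ℝ → ℝ, 0 ≤ lam →
      ContDiff ℝ ∞ u ∧ LandauKolmogorov.IsSol r k lam u := fun lam => by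
    by_cases hlam : 0 ≤ lam
    · obtain ⟨u, hu⟩ := LandauKolmogorov.exists_isSol hr k hlam
      exact ⟨u, fun _ => hu⟩
    · exact ⟨0, fun h => absurd h hlam⟩
  choose u hu using hex
  have hsm := fun lam hlam => (hu lam hlam).1
  have hsol := fun lam hlam => (hu lam hlam).2
  refine ⟨u, _, fun lam hlam => ⟨hsol lam hlam, fun v hv => hv.eqOn hr hlam (hsol lam hlam)⟩,
    ?_, ?_, rfl, ?_⟩
  · ext p
    constructor
    · intro hp
      obtain ⟨lam, hlam, hA⟩ := LandauKolmogorov.exists_norm2_D_eq hr hk' hsol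
        (LandauKolmogorov.norm2_D_le_of_mem_Gam hr hk' (hsm 0 le_rfl) (hsol 0 le_rfl) hp)
      refine ⟨lam, hlam, Prod.ext hA ?_⟩
      -- Both second coordinates are the least upper bound of the same set, so they agree.
      have h1 := hp.2.2.2
      rw [hA] at h1
      exact h1.unique (LandauKolmogorov.mem_Gam hr hk' hsm hsol hlam).2.2.2
    · rintro ⟨lam, hlam, rfl⟩
      exact LandauKolmogorov.mem_Gam hr hk' hsm hsol hlam
  · exact ⟨fun Q hQ => (hsol 0 le_rfl).abs_polynomial_le hr hk' hQ,
      fun A hA => (hsol 0 le_rfl).norm2_D_le_of_bound hr hk' (hsm 0 le_rfl) hA⟩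
  · ext A
    constructor
    · rintro ⟨lam, hlam, rfl⟩
      exact LandauKolmogorov.norm2_D_zero_le hr hk' (hsm 0 le_rfl) hsol hlam
    · exact fun hA => LandauKolmogorov.exists_norm2_D_eq hr hk' hsol hA
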